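/- **Theorem 3.3.** Let $(R,\mathfrak m,k)$ be a complete regular local ring of dimension $n$, and let $P$ be a prime ideal of $R$ of height $d$. For a finitely generated $R$-module $M$, let $\operatorname{Syz}^d(M)$ denote the $d$-th syzygy of $M$ in a minimal free resolution of $M$ over $R$ (so $\operatorname{Syz}^0(M)=M$). A module has a free summand if it has a direct summand isomorphic to $R$. Let $\Omega=\operatorname{Ext}^d_R(R/P,R)$ be the canonical module of $R/P$. Suppose that $\operatorname{Syz}^d(R/P)$ has a free summand. Then: 1. For every $R$-regular sequence $x_1,\dots,x_d$ of elements of $P$, setting $S=R/(x_1,\dots,x_d)$, there exist $\mu\in S$ and an injective $R$-linear map $\alpha:R/P\hookrightarrow S$ with $\alpha(\bar 1)=\mu$ such that the induced map $\operatorname{Ext}_R^{n-d}(k,R/P)\to\operatorname{Ext}_R^{n-d}(k,S)$ is nonzero. 2. $\operatorname{Syz}^d(\Omega)$ has a free summand. -/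

import Mathlib

open CategoryTheory CategoryTheory.Abelian

universe u

/-- A minimal free resolution
`⋯ → R^{t 2} → R^{t 1} → R^{t 0} → M → 0` of a module `M` over a local ring `R`, with finite free
terms: the augmented complex is exact and the image of each differential
`d i : R^{t (i+1)} → R^{t i}` lies in `𝔪 R^{t i}`. -/
structure MinimalFreeResolution (R : Type u) [CommRing R] [IsLocalRing R]
    (M : Type u) [AddCommGroup M] [Module R M] where
  /-- the ranks of the free modules -/
  t : ℕ → ℕ
  /-- the augmentation -/
  ε : (Fin (t 0) → R) →ₗ[R] M
  /-- the differentials -/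
  d : ∀ i : ℕ, (Fin (t (i + 1)) → R) →ₗ[R] (Fin (t i) → R)
  surjective_ε : Function.Surjective ε
  exact_zero : Function.Exact (d 0) ε
  exact_succ : ∀ i : ℕ, Function.Exact (d (i + 1)) (d i)
  minimal : ∀ i : ℕ,
    LinearMap.range (d i) ≤ IsLocalRing.maximalIdeal R • (⊤ : Submodule R (Fin (t i) → R))

/-- The `i`-th syzygy of `M` in a minimal free resolution: `M` itself for `i = 0`, and the image of
`R^{t i}` in `R^{t (i-1)}` for `i ≥ 1`. -/
def MinimalFreeResolution.syzygy {R : Type u} [CommRing R] [IsLocalRing R]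
    {M : Type u} [AddCommGroup M] [Module R M] (F : MinimalFreeResolution R M) : ℕ → ModuleCat.{u} R
  | 0 => ModuleCat.of R M
  | i + 1 => ModuleCat.of R (LinearMap.range (F.d i))

/-- `N` has a free summand: `N` is the internal direct sum of two submodules, one of which is
isomorphic to `R`. -/
def HasFreeSummand (R : Type u) [CommRing R] (N : Type u) [AddCommGroup N] [Module R N] : Prop :=
  ∃ p q : Submodule R N, IsCompl p q ∧ Nonempty (p ≃ₗ[R] R)

/-- The module `Ext_R^i(M, N)`. -/
abbrev ExtModule (R : Type u) [CommRing R] (M N : Type u) [AddCommGroup M] [Module R M]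
    [AddCommGroup N] [Module R N] (i : ℕ) : Type u :=
  Ext (ModuleCat.of R M) (ModuleCat.of R N) i

/-- The map `Ext_R^i(M, N) → Ext_R^i(M, N')` induced by an `R`-linear map `f : N → N'`. -/
noncomputable def ExtModule.map (R : Type u) [CommRing R] (M : Type u) {N N' : Type u}
    [AddCommGroup M] [Module R M] [AddCommGroup N] [Module R N] [AddCommGroup N'] [Module R N']
    (f : N →ₗ[R] N') (i : ℕ) : ExtModule R M N i →ₗ[R] ExtModule R M N' i :=
  (Ext.mk₀ (ModuleCat.ofHom f)).postcompOfLinear R (ModuleCat.of R M) (add_zero i)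

/-- A finite module over a local ring has a free cover with kernel inside `𝔪 R^n`. -/
theorem exists_minimal_cover (R : Type u) [CommRing R] [IsLocalRing R]
    (M : Type u) [AddCommGroup M] [Module R M] [Module.Finite R M] :
    ∃ (n : ℕ) (f : (Fin n → R) →ₗ[R] M), Function.Surjective f ∧
      LinearMap.ker f ≤ IsLocalRing.maximalIdeal R • (⊤ : Submodule R (Fin n → R)) := by
  classical
  have hex : ∃ n : ℕ, ∃ f : (Fin n → R) →ₗ[R] M, Function.Surjective f :=
    Module.Finite.exists_fin' R M
  obtain ⟨f, hf⟩ := Nat.find_spec hex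
  refine ⟨Nat.find hex, f, hf, fun v hv => ?_⟩
  have hmin : ∀ m < Nat.find hex, ¬ ∃ f : (Fin m → R) →ₗ[R] M, Function.Surjective f :=
    fun m hm => Nat.find_min hex hm
  generalize Nat.find hex = n at f hf v hv hmin
  have key : ∀ i, v i ∈ IsLocalRing.maximalIdeal R := by
    intro i
    by_contra hi
    rw [IsLocalRing.mem_maximalIdeal, mem_nonunits_iff, not_not] at hi
    obtain ⟨w, hw⟩ := hi
    obtain _ | m := n
    · exact i.elim0
    refine hmin m (Nat.lt_succ_self m)
      ⟨f ∘ₗ (LinearMap.pi fun j => if h : j = i then 0 else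
        LinearMap.proj (R := R) (φ := fun _ : Fin m => R) ((finSuccAboveEquiv i).symm ⟨j, h⟩)),
        fun y => ?_⟩
    obtain ⟨a, rfl⟩ := hf y
    let b : Fin (m + 1) → R := a - (a i * (↑w⁻¹ : R)) • v
    refine ⟨fun j => b (i.succAbove j), ?_⟩
    have hb : f b = f a := by
      simp only [b, map_sub, map_smul, LinearMap.mem_ker.1 hv, smul_zero, sub_zero]
    rw [← hb, LinearMap.comp_apply]
    congr 1
    ext j
    by_cases h : j = i
    · subst h
      simp [b, ← hw]
    · obtain ⟨l, rfl⟩ := Fin.exists_succAbove_eq h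
      have : (finSuccAboveEquiv i).symm ⟨i.succAbove l, h⟩ = l := by
        rw [Equiv.symm_apply_eq]; rfl
      simp [this]
  rw [pi_eq_sum_univ' v]
  exact Submodule.sum_mem _ fun i _ => Submodule.smul_mem_smul (key i) trivial

/-- Finite modules over a noetherian local ring have minimal free resolutions. -/
theorem MinimalFreeResolution.nonempty (R : Type u) [CommRing R] [IsLocalRing R]
    [IsNoetherianRing R] (M : Type u) [AddCommGroup M] [Module R M] [Module.Finite R M] :
    Nonempty (MinimalFreeResolution R M) := by
  choose n f hf hk using fun (N : { N : ModuleCat.{u} R // Module.Finite R N }) =>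
    have := N.2
    exists_minimal_cover R N.1
  let Z : ℕ → { N : ModuleCat.{u} R // Module.Finite R N } := fun i =>
    Nat.rec ⟨ModuleCat.of R M, ‹_›⟩
      (fun _ N => ⟨ModuleCat.of R (LinearMap.ker (f N)), inferInstance⟩) i
  have hd : ∀ i, LinearMap.range ((LinearMap.ker (f (Z i))).subtype ∘ₗ f (Z (i + 1))) =
      LinearMap.ker (f (Z i)) := fun i => by
    rw [LinearMap.range_comp, LinearMap.range_eq_top.2 (hf (Z (i + 1)))]
    simp
  refine ⟨⟨fun i => n (Z i), f (Z 0),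
    fun i => (LinearMap.ker (f (Z i))).subtype ∘ₗ f (Z (i + 1)), hf (Z 0), ?_, fun i => ?_,
    fun i => (hd i).le.trans (hk _)⟩⟩
  · exact LinearMap.exact_iff.2 (hd 0).symm
  · refine LinearMap.exact_iff.2 ((hd (i + 1)).trans ?_).symm
    rw [LinearMap.ker_comp, Submodule.ker_subtype]; rfl

/-!
Write `k` for the residue field. The theorem rests on one criterion: for `d ≤ n = dim R` and a module
`M` with a minimal free resolution, `Syz^d(M)` has a free summand if and only if the Yoneda pairing
`Ext^{n-d}(k, M) × Ext^d(M, R) → Ext^n(k, R)` is nonzero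
(`exists_comp_ne_zero_of_hasFreeSummand_syzygy`, `hasFreeSummand_syzygy_of_comp_ne_zero`).
Indeed classes in `Ext^d(M, R)` come from functionals `π` on `Syz^d(M)`, and, because
`Ext^i(k, R) = 0` for `i < n`, the group `Ext^{n-d}(k, M)` maps onto the part of
`Ext^n(k, Syz^d(M))` which dies in the free module containing `Syz^d(M)`. By minimality that part
contains the contribution of any free summand. Conversely a functional with values in the maximal
ideal kills `Ext^n(k, Syz^d(M))`, since `Ext^{n+1}(k, -) = 0` and elements of the maximal ideal
kill `Ext(k, -)`.

Now let `x₁, …, x_d ∈ P` be a regular sequence, `S = R / (x₁, …, x_d)` and `κ ∈ Ext^d(S, R)` the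
class of the Koszul resolution (`exists_koszul_class`). Since the `xᵢ` kill `R / P`, composition
with `κ` maps `Hom(R / P, S)` onto `Ext^d(R / P, R)`. So a class with nonzero pairing lifts to some
`α : R / P → S`, which is then nonzero on `Ext^{n-d}(k, -)`. It is injective, because an ideal `J`
strictly containing `P` satisfies `Hom(R / J, S) ⊆ Ext^d(R / J, R) = 0`
(`subsingleton_ext_of_coheight_add_lt`). This is the first claim.

For the second, composition with `κ` is also injective on `Hom(R / P, S)`, so the canonical module
`Ω` is the submodule of `S` killed by `P`. The map `α` factors through the inclusion `Ω → S`, which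
is therefore nonzero on `Ext^{n-d}(k, -)`; composed with `κ` it is a class in `Ext^d(Ω, R)` that
pairs nontrivially, and the criterion applies to `Ω` (`hasFreeSummand_syzygy_ext`).

All vanishing statements come from the fact that the maximal ideal of a regular local ring is
generated by a regular sequence (`exists_isRegular_ofList_eq_maximalIdeal`).
-/

/-! ### Regular systems of parameters -/

section RegularLocal

open IsLocalRing RingTheory.Sequence

theorem exists_le_ringKrullDim_quotient_prime {R : Type u} [CommRing R] {m : ℕ}
    (h : (m : WithBot ℕ∞) ≤ ringKrullDim R) :
    ∃ Q : Ideal R, Q.IsPrime ∧ (m : WithBot ℕ∞) ≤ ringKrullDim (R ⧸ Q) := by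
  obtain ⟨l, hl⟩ := Order.le_krullDim_iff.1 h
  refine ⟨l.head.asIdeal, l.head.isPrime, ?_⟩
  have h1 : (m : ℕ∞) ≤ Order.coheight l.head := by
    rw [← hl]
    exact Order.length_le_coheight le_rfl
  have h2 : (PrimeSpectrum.zeroLocus (R := R) l.head.asIdeal) = Set.Ici l.head := rfl
  rw [ringKrullDim_quotient, h2, ← Order.coheight_eq_krullDim_Ici]
  exact_mod_cast h1

theorem ringKrullDim_le_length_of_ofList_eq_maximalIdeal {R : Type u} [CommRing R] [IsLocalRing R]
    [IsNoetherianRing R] {rs : List R} (hrs : Ideal.ofList rs = maximalIdeal R) :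
    ringKrullDim R ≤ rs.length := by
  classical
  refine (ringKrullDim_le_spanFinrank_maximalIdeal R).trans ?_
  rw [← hrs]
  have h := Submodule.spanFinrank_span_le_ncard_of_finite (R := R) (s := {r | r ∈ rs})
    rs.finite_toSet
  have h2 : {r | r ∈ rs}.ncard ≤ rs.length := by
    rw [← List.coe_toFinset, Set.ncard_coe_finset]
    exact rs.toFinset_card_le
  exact_mod_cast h.trans h2

theorem ringKrullDim_le_ringKrullDim_quotient_span_singleton_add_one {R : Type u} [CommRing R]
    [IsLocalRing R] [IsNoetherianRing R] {x : R} (hx : x ∈ maximalIdeal R) :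
    ringKrullDim R ≤ ringKrullDim (R ⧸ Ideal.span {x}) + 1 := by
  have h := ringKrullDim_le_ringKrullDim_quotient_add_card {x}
    (by simpa [ringJacobson_eq_maximalIdeal] using! hx)
  rwa [Finset.coe_singleton, Finset.card_singleton, Nat.cast_one] at h

/-- If `dim R` elements generate the maximal ideal, they form a regular sequence and `R` is a
domain. For the first element `x`, induction makes `R / x` a domain of dimension `dim R - 1`. A
prime `Q` with `dim R / Q = dim R` does not contain `x`, and comparing the dimensions of `R / x` and
`R / (Q, x)` gives `Q ⊆ (x)`. Then `Q = x Q`, so `Q = 0` by Nakayama's lemma. -/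
theorem isDomain_and_isWeaklyRegular_of_ofList_eq_maximalIdeal (R : Type u) [CommRing R]
    [IsLocalRing R] [IsNoetherianRing R] (rs : List R)
    (hrs : Ideal.ofList rs = maximalIdeal R) (hdim : (rs.length : WithBot ℕ∞) ≤ ringKrullDim R) :
    IsDomain R ∧ IsWeaklyRegular R rs := by
  generalize hn : rs.length = n at hdim
  induction n generalizing R rs with
  | zero =>
    obtain rfl := List.length_eq_zero_iff.1 hn
    rw [Ideal.ofList_nil, eq_comm] at hrs
    exact ⟨(isField_iff_maximalIdeal_eq.2 hrs).isDomain, .nil R R⟩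
  | succ n ih =>
    obtain _ | ⟨x, rs⟩ := rs
    · simp at hn
    have hlen : rs.length = n := by simpa using hn
    have hx : x ∈ maximalIdeal R := by
      rw [← hrs]; exact Ideal.subset_span (by simp)
    have hxne : Ideal.span {x} ≠ ⊤ := fun h =>
      (maximalIdeal.isMaximal R).ne_top (top_le_iff.1 (h ▸ (Ideal.span_singleton_le_iff_mem _).2 hx))
    have : Nontrivial (R ⧸ Ideal.span {x}) := Ideal.Quotient.nontrivial_iff.2 hxne
    have : IsLocalRing (R ⧸ Ideal.span {x}) :=
      .of_surjective' (Ideal.Quotient.mk _) Ideal.Quotient.mk_surjective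
    have hmax : Ideal.ofList (rs.map (Ideal.Quotient.mk (Ideal.span {x}))) =
        maximalIdeal (R ⧸ Ideal.span {x}) := by
      have h1 := map_maximalIdeal_of_surjective (Ideal.Quotient.mk (Ideal.span {x}))
        Ideal.Quotient.mk_surjective
      rw [← h1, ← hrs, Ideal.map_ofList, List.map_cons, Ideal.ofList_cons]
      have : Ideal.Quotient.mk (Ideal.span {x}) x = 0 :=
        Ideal.Quotient.eq_zero_iff_mem.2 (Ideal.mem_span_singleton_self x)
      simp [this]
    have hle : ringKrullDim (R ⧸ Ideal.span {x}) ≤ n := by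
      simpa [hlen] using ringKrullDim_le_length_of_ofList_eq_maximalIdeal hmax
    have hge : (n : WithBot ℕ∞) ≤ ringKrullDim (R ⧸ Ideal.span {x}) := by
      have h1 := hdim.trans (ringKrullDim_le_ringKrullDim_quotient_span_singleton_add_one hx)
      push_cast at h1
      exact ENat.WithBot.add_le_add_one_right_iff.1 h1
    obtain ⟨hdom, hreg⟩ := ih _ (rs.map (Ideal.Quotient.mk (Ideal.span {x}))) hmax (by simpa) hge
    obtain ⟨Q, hQ, hQdim⟩ := exists_le_ringKrullDim_quotient_prime hdim
    have hxQ : x ∉ Q := by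
      intro h
      have h1 := ringKrullDim_le_of_surjective
        (Ideal.Quotient.factor ((Ideal.span_singleton_le_iff_mem Q).2 h))
        (Ideal.Quotient.factor_surjective _)
      have := (hQdim.trans h1).trans hle
      norm_cast at this
      omega
    -- Otherwise the kernel of `R / x → R / (Q, x)` contains a nonzerodivisor, so the dimension
    -- drops.
    have hQx : Q ≤ Ideal.span {x} := by
      by_contra hcon
      obtain ⟨q, hq, hqx⟩ := Set.not_subset.1 hcon
      have : IsLocalRing (R ⧸ Q) :=
        .of_surjective' (Ideal.Quotient.mk _) Ideal.Quotient.mk_surjective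
      have hx' : Ideal.Quotient.mk Q x ∈ maximalIdeal (R ⧸ Q) := by
        rw [← map_maximalIdeal_of_surjective _ Ideal.Quotient.mk_surjective]
        exact Ideal.mem_map_of_mem _ hx
      have h1 := ringKrullDim_le_ringKrullDim_quotient_span_singleton_add_one hx'
      let f : R ⧸ Ideal.span {x} →+*
        ((R ⧸ Q) ⧸ Ideal.span {Ideal.Quotient.mk Q x}) :=
        Ideal.Quotient.lift _ ((Ideal.Quotient.mk _).comp (Ideal.Quotient.mk Q)) (by
          intro a ha
          obtain ⟨b, rfl⟩ := Ideal.mem_span_singleton'.1 ha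
          rw [RingHom.comp_apply, map_mul, Ideal.Quotient.eq_zero_iff_mem]
          exact Ideal.mul_mem_left _ _ (Ideal.mem_span_singleton_self _))
      have hf : Function.Surjective f := Ideal.Quotient.lift_surjective_of_surjective _ _
        (Ideal.Quotient.mk_surjective.comp Ideal.Quotient.mk_surjective)
      have h2 := ringKrullDim_succ_le_of_surjective f hf (r := Ideal.Quotient.mk _ q)
        (mem_nonZeroDivisors_of_ne_zero (by rwa [Ne, Ideal.Quotient.eq_zero_iff_mem])) (by
          simp only [f, Ideal.Quotient.lift_mk, RingHom.comp_apply]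
          rw [Ideal.Quotient.eq_zero_iff_mem.2 hq, map_zero])
      have := (hQdim.trans h1).trans (h2.trans hle)
      norm_cast at this
      omega
    have hQ0 : Q = ⊥ := by
      refine Submodule.eq_bot_of_le_smul_of_le_jacobson_bot (maximalIdeal R) Q
        (IsNoetherian.noetherian Q) ?_ (maximalIdeal_le_jacobson _)
      intro q hq
      obtain ⟨a, rfl⟩ := Ideal.mem_span_singleton'.1 (hQx hq)
      rw [mul_comm]
      exact Submodule.smul_mem_smul hx ((hQ.mem_or_mem hq).resolve_right hxQ)
    have hR : IsDomain R := by
      subst hQ0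
      exact (RingEquiv.quotientBot R).symm.isDomain
    have hx0 : x ≠ 0 := fun h => hxQ (h ▸ Q.zero_mem)
    refine ⟨hR, .cons (IsSMulRegular.of_ne_zero hx0) ?_⟩
    have h1 := (isWeaklyRegular_map_algebraMap_iff (R := R) (S := R ⧸ Ideal.span {x})
      (R ⧸ Ideal.span {x}) rs).1 hreg
    exact ((Submodule.quotEquivOfEq _ _ (by
      rw [← Submodule.ideal_span_singleton_smul]; simp)).isWeaklyRegular_congr rs).1 h1

theorem exists_isRegular_ofList_eq_maximalIdeal (R : Type u) [CommRing R] [IsRegularLocalRing R]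
    {n : ℕ} (hn : ringKrullDim R = n) :
    ∃ rs : List R, rs.length = n ∧ Ideal.ofList rs = maximalIdeal R ∧ IsRegular R rs := by
  obtain ⟨s, hs, hspan⟩ := Submodule.FG.exists_span_finset_card_eq_spanFinrank
    (IsNoetherian.noetherian (maximalIdeal R))
  have hcard : s.card = n := by
    have := IsRegularLocalRing.spanFinrank_maximalIdeal (R := R)
    rw [hn, ← hs] at this
    exact_mod_cast this
  have hlist : Ideal.ofList s.toList = maximalIdeal R := by
    rw [← hspan]
    simp [Ideal.ofList]
  refine ⟨s.toList, by simpa, hlist, ?_⟩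
  refine .of_isWeaklyRegular_of_mem_maximalIdeal R (fun r hr => ?_)
    (isDomain_and_isWeaklyRegular_of_ofList_eq_maximalIdeal R _ hlist (by simp [hn, hcard])).2
  rw [← hlist]
  exact Ideal.subset_span hr

end RegularLocal

/-! ### Elementary facts on `Ext` -/

section ExtBasics

open IsLocalRing

variable {R : Type u} [CommRing R]

theorem CategoryTheory.Abelian.Ext.smul_eq_mk₀_comp {M N : ModuleCat.{u} R} {i : ℕ} (r : R)
    (x : Ext M N i) : r • x = (Ext.mk₀ (r • 𝟙 M)).comp x (zero_add i) := by
  simp [Ext.mk₀_smul]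

theorem CategoryTheory.Abelian.Ext.smul_eq_zero_of_mem_annihilator {M N : ModuleCat.{u} R} {i : ℕ}
    {r : R} (hr : r ∈ Module.annihilator R M) (x : Ext M N i) : r • x = 0 := by
  have h : r • 𝟙 M = 0 := by
    ext m
    exact Module.mem_annihilator.1 hr m
  rw [Ext.smul_eq_mk₀_comp, h, Ext.mk₀_zero, Ext.zero_comp]

theorem CategoryTheory.Abelian.Ext.subsingleton_of_linearEquiv {M M' : Type u} [AddCommGroup M]
    [Module R M] [AddCommGroup M'] [Module R M'] (e : M ≃ₗ[R] M') {N : ModuleCat.{u} R} {i : ℕ}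
    (h : Subsingleton (Ext (ModuleCat.of R M') N i)) :
    Subsingleton (Ext (ModuleCat.of R M) N i) := by
  refine subsingleton_of_forall_eq 0 fun x => ?_
  have h1 : ModuleCat.ofHom e.toLinearMap ≫ ModuleCat.ofHom e.symm.toLinearMap =
      𝟙 (ModuleCat.of R M) := by
    ext; simp
  have h2 : x = (Ext.mk₀ (ModuleCat.ofHom e.toLinearMap)).comp
      ((Ext.mk₀ (ModuleCat.ofHom e.symm.toLinearMap)).comp x (zero_add i)) (zero_add i) := by
    rw [Ext.mk₀_comp_mk₀_assoc, h1, Ext.mk₀_id_comp]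
  rw [h2, Subsingleton.elim ((Ext.mk₀ (ModuleCat.ofHom e.symm.toLinearMap)).comp x (zero_add i)) 0,
    Ext.comp_zero]

/-- A class with values in `R^t` is the sum of its coordinates. -/
theorem CategoryTheory.Abelian.Ext.eq_sum_proj_comp_single {N : ModuleCat.{u} R} {t i : ℕ}
    (w : Ext N (ModuleCat.of R (Fin t → R)) i) :
    w = ∑ j, (w.comp (Ext.mk₀ (ModuleCat.ofHom (LinearMap.proj j))) (add_zero i)).comp
      (Ext.mk₀ (ModuleCat.ofHom (LinearMap.single R (fun _ => R) j))) (add_zero i) := by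
  have h : 𝟙 (ModuleCat.of R (Fin t → R)) = ∑ j, ModuleCat.ofHom (LinearMap.proj j) ≫
      ModuleCat.ofHom (LinearMap.single R (fun _ : Fin t => R) j) := by
    ext1
    rw [ModuleCat.hom_sum]
    ext j k
    simp [Pi.single_apply]
  conv_lhs => rw [← w.comp_mk₀_id, h, Ext.mk₀_sum, Ext.comp_sum]
  refine Finset.sum_congr rfl fun j _ => ?_
  rw [← Ext.mk₀_comp_mk₀, Ext.comp_assoc_of_third_deg_zero]

variable [IsLocalRing R]

theorem annihilator_residueField : Module.annihilator R (ResidueField R) = maximalIdeal R :=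
  Ideal.annihilator_quotient

/-- Elements of the maximal ideal annihilate `Ext(k, -)`, so an endomorphism of `R` that takes
values in the maximal ideal induces zero. -/
theorem comp_mk₀_eq_zero_of_apply_one_mem {i : ℕ}
    (u : Ext (ModuleCat.of R (ResidueField R)) (ModuleCat.of R R) i) (φ : R →ₗ[R] R)
    (hφ : φ 1 ∈ maximalIdeal R) : u.comp (Ext.mk₀ (ModuleCat.ofHom φ)) (add_zero i) = 0 := by
  have h : ModuleCat.ofHom φ = φ 1 • 𝟙 (ModuleCat.of R R) := by
    ext
    simp
  rw [h, ← Ext.smul_eq_comp_mk₀]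
  exact Ext.smul_eq_zero_of_mem_annihilator (by rwa [← annihilator_residueField] at hφ) u

end ExtBasics

/-! ### The Koszul class of a regular sequence -/

section KoszulClass

open RingTheory.Sequence

variable {R : Type u} [CommRing R]

/-- The class of `0 → M → M → M / r M → 0`, with the two consequences of its long exact sequence. -/
theorem exists_extClass_quotSMulTop {M : ModuleCat.{u} R} {r : R} (h : IsSMulRegular M r) :
    ∃ ε : Ext (ModuleCat.of R (QuotSMulTop r M)) M 1,
      (∀ (N : ModuleCat.{u} R) (i j : ℕ) (hij : i + 1 = j) (y : Ext N M j), r • y = 0 →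
        ∃ x : Ext N (ModuleCat.of R (QuotSMulTop r M)) i, x.comp ε hij = y) ∧
      (∀ (N : ModuleCat.{u} R) (i j : ℕ) (hij : i + 1 = j)
        (x : Ext N (ModuleCat.of R (QuotSMulTop r M)) i), Subsingleton (Ext N M i) →
        x.comp ε hij = 0 → x = 0) := by
  have hS := h.smulShortComplex_shortExact
  refine ⟨hS.extClass, fun N i j hij y hy => ?_, fun N i j hij x _ hx => ?_⟩
  · rw [Ext.smul_eq_comp_mk₀] at hy
    exact Ext.covariant_sequence_exact₁ N hS y hy hij
  · obtain ⟨w, rfl⟩ := Ext.covariant_sequence_exact₃ N hS x hij hx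
    have hw : w = 0 := Subsingleton.elim (α := Ext N M i) _ _
    subst hw
    exact Ext.zero_comp N (Y := M) _ _ _ _

/-- The Yoneda class of the Koszul resolution of `T = M / (rs) M`. Composition with it is the
iterated connecting map of the sequences `0 → M → M → M / r M → 0`: it is surjective on modules
killed by `rs`, since multiplication by each `r` is zero there, and injective where the lower `Ext`
groups with values in `M` vanish. -/
theorem exists_koszul_class (rs : List R) (M T : ModuleCat.{u} R)
    (e : T ≃ₗ[R] M ⧸ (Ideal.ofList rs • ⊤ : Submodule R M)) (h : IsWeaklyRegular M rs) :
    ∃ κ : Ext T M rs.length,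
      (∀ N : ModuleCat.{u} R, (∀ r ∈ rs, r ∈ Module.annihilator R N) →
        ∀ (i j : ℕ) (hij : i + rs.length = j) (y : Ext N M j), ∃ x : Ext N T i, x.comp κ hij = y) ∧
      (∀ (N : ModuleCat.{u} R) (i j : ℕ) (hij : i + rs.length = j),
        (∀ l < j, Subsingleton (Ext N M l)) → ∀ x : Ext N T i, x.comp κ hij = 0 → x = 0) := by
  induction rs generalizing M with
  | nil =>
    let e' : T ≃ₗ[R] M := e.trans (Submodule.quotEquivOfEqBot _ (by simp))
    have h1 : ModuleCat.ofHom e'.toLinearMap ≫ ModuleCat.ofHom e'.symm.toLinearMap = 𝟙 T := by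
      ext; simp
    have h2 : ModuleCat.ofHom e'.symm.toLinearMap ≫ ModuleCat.ofHom e'.toLinearMap = 𝟙 M := by
      ext; simp
    refine ⟨Ext.mk₀ (ModuleCat.ofHom e'.toLinearMap), fun N _ i j hij y => ?_,
      fun N i j hij _ x hx => ?_⟩
    · obtain rfl : i = j := hij
      refine ⟨y.comp (Ext.mk₀ (ModuleCat.ofHom e'.symm.toLinearMap)) (add_zero i), ?_⟩
      change Ext.comp _ _ (add_zero i) = y
      rw [Ext.comp_assoc_of_third_deg_zero, Ext.mk₀_comp_mk₀, h2, Ext.comp_mk₀_id]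
    · obtain rfl : i = j := hij
      rw [← x.comp_mk₀_id, ← h1, ← Ext.mk₀_comp_mk₀, ← Ext.comp_assoc_of_third_deg_zero]
      change x.comp _ (add_zero i) = 0 at hx
      rw [hx, Ext.zero_comp]
  | cons r rs ih =>
    rw [isWeaklyRegular_cons_iff] at h
    obtain ⟨κ, hsurj, hinj⟩ := ih (ModuleCat.of R (QuotSMulTop r M))
      (e.trans (Submodule.quotOfListConsSMulTopEquivQuotSMulTopInner M r rs)) h.2
    obtain ⟨ε, hεsurj, hεinj⟩ := exists_extClass_quotSMulTop h.1
    refine ⟨κ.comp ε rfl, fun N hN i j hij y => ?_, fun N i j hij hv x hx => ?_⟩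
    · rw [List.length_cons] at hij
      obtain ⟨y', rfl⟩ := hεsurj N (i + rs.length) j (by omega) y
        (Ext.smul_eq_zero_of_mem_annihilator (hN r (by simp)) y)
      obtain ⟨x, rfl⟩ := hsurj N (fun s hs => hN s (by simp [hs])) i _ rfl y'
      exact ⟨x, (Ext.comp_assoc _ _ _ rfl rfl (by omega)).symm⟩
    · rw [List.length_cons] at hij
      refine hinj N i (i + rs.length) rfl (fun l hl => ?_) x ?_
      · have := hv (l + 1) (by omega)
        exact subsingleton_of_forall_eq 0 fun z =>
          hεinj N l (l + 1) rfl z (hv l (by omega)) (Subsingleton.elim _ _)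
      · exact hεinj N _ j (by omega) _ (hv _ (by omega))
          ((Ext.comp_assoc _ _ _ rfl rfl (by omega)).trans hx)

end KoszulClass

/-! ### Vanishing of `Ext` over a regular local ring -/

section Vanishing

open IsLocalRing RingTheory.Sequence

theorem Module.support_quotient_eq_zeroLocus {R : Type u} [CommRing R] (I : Ideal R) :
    Module.support R (R ⧸ I) = PrimeSpectrum.zeroLocus I := by
  rw [Module.support_eq_zeroLocus, Ideal.annihilator_quotient]

variable {R : Type u} [CommRing R] [IsRegularLocalRing R] {n : ℕ}

theorem subsingleton_ext_residueField_of_lt (hn : ringKrullDim R = n) {i : ℕ} (hi : i < n) :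
    Subsingleton (Ext (ModuleCat.of R (ResidueField R)) (ModuleCat.of R R) i) := by
  obtain ⟨rs, hlen, hspan, hreg⟩ := exists_isRegular_ofList_eq_maximalIdeal R hn
  refine ModuleCat.subsingleton_ext_of_exists_isRegular (maximalIdeal R)
    (ModuleCat.of R (ResidueField R)) ?_ (ModuleCat.of R R) ?_ rs ?_ hreg i (by omega)
  · rw [Module.support_eq_zeroLocus]
    exact PrimeSpectrum.zeroLocus_anti_mono annihilator_residueField.ge
  · simpa [lt_top_iff_ne_top] using (maximalIdeal.isMaximal R).ne_top
  · rw [← hspan]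
    exact fun r hr => Ideal.subset_span hr

theorem nonempty_residueField_equiv_quotient {rs : List R}
    (hspan : Ideal.ofList rs = maximalIdeal R) :
    Nonempty (ResidueField R ≃ₗ[R] R ⧸ (Ideal.ofList rs • ⊤ : Submodule R R)) :=
  ⟨(LinearMap.quotKerEquivOfSurjective (Algebra.linearMap R (ResidueField R))
    residue_surjective).symm.trans (Submodule.quotEquivOfEq _ _ (by
      rw [hspan]
      ext r
      simp [ResidueField.algebraMap_eq, residue_eq_zero_iff]))⟩

/-- `Ext^n(k, R)` contains the nonzero Koszul class of a regular system of parameters. -/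
theorem exists_ext_residueField_ne_zero (hn : ringKrullDim R = n) :
    ∃ u : Ext (ModuleCat.of R (ResidueField R)) (ModuleCat.of R R) n, u ≠ 0 := by
  obtain ⟨rs, hlen, hspan, hreg⟩ := exists_isRegular_ofList_eq_maximalIdeal R hn
  obtain ⟨e⟩ := nonempty_residueField_equiv_quotient hspan
  obtain ⟨κ, -, hinj⟩ := exists_koszul_class rs (ModuleCat.of R R)
    (ModuleCat.of R (ResidueField R)) e hreg.1
  subst hlen
  refine ⟨κ, fun hκ => ?_⟩
  have h := hinj (ModuleCat.of R (ResidueField R)) 0 rs.length (zero_add _)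
    (fun l hl => subsingleton_ext_residueField_of_lt hn hl) (Ext.mk₀ (𝟙 _)) (by
      rw [hκ, Ext.comp_zero])
  rw [Ext.mk₀_eq_zero_iff] at h
  have h1 : (1 : ResidueField R) = 0 := by
    simpa using congrArg (fun f : ModuleCat.of R (ResidueField R) ⟶ _ =>
      f.hom (1 : ResidueField R)) h
  exact one_ne_zero h1

theorem subsingleton_ext_residueField_succ (hn : ringKrullDim R = n) (N : ModuleCat.{u} R) :
    Subsingleton (Ext (ModuleCat.of R (ResidueField R)) N (n + 1)) := by
  obtain ⟨rs, hlen, hspan, hreg⟩ := exists_isRegular_ofList_eq_maximalIdeal R hn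
  obtain ⟨e⟩ := nonempty_residueField_equiv_quotient hspan
  have h := ModuleCat.projectiveDimension_quotient_eq_add_length_of_isWeaklyRegular
    (ModuleCat.of R R) rs hreg.1 (by rw [← hspan]; exact fun r hr => Ideal.subset_span hr)
  rw [ModuleCat.projectiveDimension_eq_zero_of_projective (ModuleCat.of R R), zero_add, hlen] at h
  have : HasProjectiveDimensionLE (ModuleCat.of R (R ⧸ (Ideal.ofList rs • ⊤ : Submodule R R))) n :=
    (projectiveDimension_le_iff _ _).1 h.le
  exact Ext.subsingleton_of_linearEquiv e
    (HasProjectiveDimensionLT.subsingleton _ (n + 1) (n + 1) le_rfl N)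

/-- Vanishing of `Ext^i(N, R)` for `i < n - dim N`: by prime filtrations it reduces to `N = R / Q`,
where a parameter `x ∉ Q` acts surjectively on `Ext^i(R / Q, R)` by descending induction on `i`,
and Nakayama's lemma applies. -/
theorem subsingleton_ext_of_coheight_add_lt (hn : ringKrullDim R = n) (N : Type u)
    [AddCommGroup N] [Module R N] [hN : Module.Finite R N] (i : ℕ)
    (h : ∀ Q ∈ Module.support R N, Order.coheight Q + i < n) :
    Subsingleton (Ext (ModuleCat.of R N) (ModuleCat.of R R) i) := by
  induction hm : n - i using Nat.strong_induction_on generalizing N i with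
  | _ m ih =>
  induction hN using IsNoetherianRing.induction_on_isQuotientEquivQuotientPrime R with
  | subsingleton N =>
    refine subsingleton_of_forall_eq 0 fun x => ?_
    rw [← one_smul R x]
    exact Ext.smul_eq_zero_of_mem_annihilator
      (Module.mem_annihilator.2 fun _ => Subsingleton.elim (α := N) _ _) x
  | quotient N Q e =>
    refine Ext.subsingleton_of_linearEquiv e ?_
    rw [e.support_eq, Module.support_quotient_eq_zeroLocus] at h
    have hi : i < n := by
      have := (le_add_self).trans_lt (h Q (fun _ => id))
      exact_mod_cast this
    by_cases hQ : Q.asIdeal = maximalIdeal R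
    · rw [hQ]
      exact subsingleton_ext_residueField_of_lt hn hi
    obtain ⟨x, hx, hxQ⟩ := SetLike.exists_of_lt
      (lt_of_le_of_ne (le_maximalIdeal Q.isPrime.ne_top) hQ)
    have hreg : IsSMulRegular (R ⧸ Q.asIdeal) x := by
      have hne : Ideal.Quotient.mk Q.asIdeal x ≠ 0 := by
        rwa [Ne, Ideal.Quotient.eq_zero_iff_mem]
      exact fun a b hab => mul_left_cancel₀ hne (by simpa [Algebra.smul_def] using! hab)
    have hS := hreg.smulShortComplex_shortExact (M := ModuleCat.of R (R ⧸ Q.asIdeal))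
    have hvan : Subsingleton (Ext (ModuleCat.of R (QuotSMulTop x (R ⧸ Q.asIdeal)))
        (ModuleCat.of R R) (i + 1)) := by
      refine ih (n - (i + 1)) (by omega) _ (i + 1) (fun Q' hQ' => ?_) rfl
      rw [Module.support_quotSMulTop, Module.support_quotient_eq_zeroLocus] at hQ'
      have hlt : Q < Q' := by
        refine lt_of_le_of_ne hQ'.1 ?_
        rintro rfl
        exact hxQ (hQ'.2 rfl)
      refine lt_of_le_of_lt ?_ (h Q (fun _ => id))
      have := Order.coheight_add_one_le hlt
      calc _ = Order.coheight Q' + 1 + i := by push_cast; ring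
        _ ≤ _ := by gcongr
    have htop : (⊤ : Submodule R (Ext (ModuleCat.of R (R ⧸ Q.asIdeal)) (ModuleCat.of R R) i)) ≤
        maximalIdeal R • ⊤ := by
      intro y _
      obtain ⟨z, hz⟩ := Ext.contravariant_sequence_exact₁ hS (ModuleCat.of R R) y (add_comm 1 i)
        (Subsingleton.elim (α := Ext (ModuleCat.of R (QuotSMulTop x (R ⧸ Q.asIdeal)))
          (ModuleCat.of R R) (i + 1)) _ _)
      have hz' : x • z = y := (Ext.smul_eq_mk₀_comp x z).trans hz
      rw [← hz']
      exact Submodule.smul_mem_smul hx trivial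
    have := Submodule.eq_bot_of_le_smul_of_le_jacobson_bot (maximalIdeal R) ⊤
      Module.Finite.fg_top htop (maximalIdeal_le_jacobson _)
    exact (Submodule.subsingleton_iff R).1 (subsingleton_of_bot_eq_top this.symm)
  | exact N₁ N₂ N₃ f g hf hg hfg h₁ h₃ =>
    rw [Module.support_of_exact hfg hf hg] at h
    have h₁ := h₁ fun Q hQ => h Q (Or.inl hQ)
    have h₃ := h₃ fun Q hQ => h Q (Or.inr hQ)
    have hS := ModuleCat.shortComplex_shortExact
      (ModuleCat.shortComplexOfCompEqZero f g hfg.linearMap_comp_eq_zero) hfg hf hg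
    refine subsingleton_of_forall_eq 0 fun x => ?_
    obtain ⟨y, rfl⟩ := Ext.contravariant_sequence_exact₂ hS _ x
      (Subsingleton.elim (α := Ext (ModuleCat.of R N₁) (ModuleCat.of R R) i) _ _)
    rw [Subsingleton.elim (α := Ext (ModuleCat.of R N₃) (ModuleCat.of R R) i) y 0]
    exact Ext.comp_zero (Y := ModuleCat.of R N₃) _ _ _ _ _

theorem height_add_coheight_le_of_ringKrullDim_eq (hn : ringKrullDim R = n) (P : PrimeSpectrum R) :
    P.asIdeal.height + Order.coheight P ≤ n := by
  have h := Order.krullDim_eq_iSup_height_add_coheight_of_nonempty (α := PrimeSpectrum R)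
  rw [← ringKrullDim, hn] at h
  have h2 : (n : ℕ∞) = ⨆ a : PrimeSpectrum R, Order.height a + Order.coheight a := by
    exact_mod_cast h
  rw [PrimeSpectrum.height_eq_orderHeight, h2]
  exact le_iSup (fun a : PrimeSpectrum R => Order.height a + Order.coheight a) P

/-- The grade of a prime of height `d` is at least `d`. -/
theorem subsingleton_ext_quotient_of_lt_height (hn : ringKrullDim R = n) (P : Ideal R)
    [hP : P.IsPrime] {d i : ℕ} (hd : P.height = d) (hi : i < d) :
    Subsingleton (Ext (ModuleCat.of R (R ⧸ P)) (ModuleCat.of R R) i) := by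
  refine subsingleton_ext_of_coheight_add_lt hn _ i fun Q hQ => ?_
  rw [Module.support_quotient_eq_zeroLocus] at hQ
  have h := height_add_coheight_le_of_ringKrullDim_eq hn ⟨P, hP⟩
  have h2 : Order.coheight Q ≤ Order.coheight (⟨P, hP⟩ : PrimeSpectrum R) :=
    Order.coheight_anti hQ
  simp only [hd] at h
  lift Order.coheight (⟨P, hP⟩ : PrimeSpectrum R) to ℕ using
    ne_top_of_le_ne_top (ENat.natCast_ne_top n) (le_add_self.trans h) with b
  lift Order.coheight Q to ℕ using
    ne_top_of_le_ne_top (ENat.natCast_ne_top b) h2 with a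
  norm_cast at *
  omega

/-- An ideal strictly containing a prime of height `d` has grade greater than `d`. -/
theorem subsingleton_ext_quotient_of_lt (hn : ringKrullDim R = n) (P J : Ideal R)
    [hP : P.IsPrime] {d i : ℕ} (hd : P.height = d) (hJ : P < J) (hi : i ≤ d) :
    Subsingleton (Ext (ModuleCat.of R (R ⧸ J)) (ModuleCat.of R R) i) := by
  refine subsingleton_ext_of_coheight_add_lt hn _ i fun Q hQ => ?_
  rw [Module.support_quotient_eq_zeroLocus] at hQ
  have h := height_add_coheight_le_of_ringKrullDim_eq hn ⟨P, hP⟩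
  have hlt : (⟨P, hP⟩ : PrimeSpectrum R) < Q := hJ.trans_le (b := J) (c := Q.asIdeal) hQ
  have h2 := Order.coheight_add_one_le hlt
  simp only [hd] at h
  lift Order.coheight (⟨P, hP⟩ : PrimeSpectrum R) to ℕ using
    ne_top_of_le_ne_top (ENat.natCast_ne_top n) (le_add_self.trans h) with b
  lift Order.coheight Q to ℕ using
    ne_top_of_le_ne_top (ENat.natCast_ne_top b) (le_self_add.trans h2) with a
  norm_cast at *
  omega

theorem exists_isRegular_of_height (hn : ringKrullDim R = n) (P : Ideal R) [P.IsPrime] {d : ℕ}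
    (hd : P.height = d) :
    ∃ rs : List R, rs.length = d ∧ (∀ r ∈ rs, r ∈ P) ∧ IsRegular R rs := by
  refine ModuleCat.exists_isRegular_of_exists_subsingleton_ext P d (ModuleCat.of R R) ?_
    (ModuleCat.of R (R ⧸ P)) ?_ fun i hi => subsingleton_ext_quotient_of_lt_height hn P hd hi
  · simpa [lt_top_iff_ne_top] using Ideal.IsPrime.ne_top ‹_›
  · exact Module.support_quotient_eq_zeroLocus P

end Vanishing

/-! ### Free summands of syzygies and the Yoneda pairing -/

section Syzygies

open IsLocalRing

variable {R : Type u} [CommRing R]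

theorem apply_mem_of_mem_smul_top {I : Ideal R} {t : ℕ} {v : Fin t → R}
    (hv : v ∈ I • (⊤ : Submodule R (Fin t → R))) (j : Fin t) : v j ∈ I := by
  refine Submodule.smul_induction_on hv (fun r hr w _ => ?_) fun w w' h h' => I.add_mem h h'
  exact I.mul_mem_right _ hr

theorem hasFreeSummand_of_surjective {N : Type u} [AddCommGroup N] [Module R N] (π : N →ₗ[R] R)
    (hπ : Function.Surjective π) : HasFreeSummand R N := by
  obtain ⟨z, hz⟩ := hπ 1
  have h : π ∘ₗ LinearMap.toSpanSingleton R N z = LinearMap.id := by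
    ext; simp [hz]
  refine ⟨LinearMap.range (LinearMap.toSpanSingleton R N z), LinearMap.ker π, ⟨?_, ?_⟩,
    ⟨(LinearEquiv.ofInjective _ (LinearMap.injective_of_comp_eq_id _ _ h)).symm⟩⟩
  · rw [Submodule.disjoint_def]
    rintro _ ⟨a, rfl⟩ ha
    have ha' : a = 0 := by simpa [hz] using ha
    rw [ha', map_zero]
  · rw [codisjoint_iff, eq_top_iff]
    intro x _
    rw [← add_sub_cancel (π x • z) x]
    exact Submodule.add_mem_sup ⟨π x, rfl⟩ (by simp [hz])

theorem HasFreeSummand.exists_retract {N : ModuleCat.{u} R} (h : HasFreeSummand R N) :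
    ∃ (σ : ModuleCat.of R R ⟶ N) (π : N ⟶ ModuleCat.of R R), σ ≫ π = 𝟙 _ := by
  obtain ⟨p, q, hpq, ⟨e⟩⟩ := h
  refine ⟨ModuleCat.ofHom (p.subtype ∘ₗ e.symm.toLinearMap),
    ModuleCat.ofHom (e.toLinearMap ∘ₗ p.projectionOnto q hpq), ?_⟩
  ext
  simp

variable [IsLocalRing R] {M : Type u} [AddCommGroup M] [Module R M]

/-- The short exact sequence `0 → Syz^{d+1}(M) → R^{t d} → Syz^d(M) → 0`; minimality puts the
coordinates of the first map in the maximal ideal. -/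
theorem MinimalFreeResolution.exists_syzygy_sequence (F : MinimalFreeResolution R M) (d : ℕ) :
    ∃ (ι : F.syzygy (d + 1) ⟶ ModuleCat.of R (Fin (F.t d) → R))
      (p : ModuleCat.of R (Fin (F.t d) → R) ⟶ F.syzygy d) (w : ι ≫ p = 0),
      (ShortComplex.mk ι p w).ShortExact ∧ ∀ z j, ι.hom z j ∈ maximalIdeal R := by
  have hmin (d : ℕ) (z : LinearMap.range (F.d d)) (j) :
      (LinearMap.range (F.d d)).subtype z j ∈ maximalIdeal R :=
    apply_mem_of_mem_smul_top (F.minimal d z.2) j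
  obtain _ | d := d
  · have hex : Function.Exact (LinearMap.range (F.d 0)).subtype F.ε := by
      intro v
      rw [F.exact_zero v, Submodule.coe_subtype, Subtype.range_coe]
      rfl
    exact ⟨ModuleCat.ofHom (LinearMap.range (F.d 0)).subtype, ModuleCat.ofHom F.ε,
      ModuleCat.hom_ext hex.linearMap_comp_eq_zero,
      ModuleCat.shortComplex_shortExact _ hex Subtype.val_injective F.surjective_ε, hmin 0⟩
  · have hex : Function.Exact (LinearMap.range (F.d (d + 1))).subtype (F.d d).rangeRestrict := by
      intro v
      rw [Submodule.coe_subtype, Subtype.range_coe]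
      exact Iff.trans Subtype.ext_iff (F.exact_succ d v)
    exact ⟨ModuleCat.ofHom (LinearMap.range (F.d (d + 1))).subtype,
      ModuleCat.ofHom (F.d d).rangeRestrict, ModuleCat.hom_ext hex.linearMap_comp_eq_zero,
      ModuleCat.shortComplex_shortExact _ hex Subtype.val_injective
        (F.d d).surjective_rangeRestrict, hmin (d + 1)⟩

/-- The Yoneda class of `0 → Syz^d(M) → R^{t (d-1)} → ⋯ → R^{t 0} → M → 0`. Every class out of `M`
of degree at least `d` factors through it; and if the lower `Ext` groups of `N` with values in `R`
vanish, a class with values in `Syz^d(M)` factors through it once it is killed by all functionals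
with values in the maximal ideal, such as the coordinates of `Syz^d(M) → R^{t (d-1)}`. -/
theorem MinimalFreeResolution.exists_syzygy_class (F : MinimalFreeResolution R M) (d : ℕ) :
    ∃ η : Ext (ModuleCat.of R M) (F.syzygy d) d,
      (∀ (Y : ModuleCat.{u} R) (i j : ℕ) (hij : d + i = j) (a : Ext (ModuleCat.of R M) Y j),
        ∃ b : Ext (F.syzygy d) Y i, η.comp b hij = a) ∧
      (∀ (N : ModuleCat.{u} R) (i j : ℕ) (hij : i + d = j),
        (∀ l < j, Subsingleton (Ext N (ModuleCat.of R R) l)) → ∀ ζ : Ext N (F.syzygy d) j,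
        (∀ φ : F.syzygy d ⟶ ModuleCat.of R R, (∀ z, φ.hom z ∈ maximalIdeal R) →
          ζ.comp (Ext.mk₀ φ) (add_zero j) = 0) →
        ∃ ξ : Ext N (ModuleCat.of R M) i, ξ.comp η hij = ζ) := by
  induction d with
  | zero =>
    refine ⟨Ext.mk₀ (𝟙 _), fun Y i j hij a => ?_, fun N i j hij _ ζ _ => ?_⟩
    · obtain rfl : i = j := by omega
      exact ⟨a, Ext.mk₀_id_comp _⟩
    · obtain rfl : i = j := by omega
      exact ⟨ζ, Ext.comp_mk₀_id _⟩
  | succ d ih =>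
    obtain ⟨η, h₁, h₂⟩ := ih
    obtain ⟨ι, p, w, hS, hmem⟩ := F.exists_syzygy_sequence d
    obtain ⟨ε, hε⟩ : ∃ ε : Ext (F.syzygy d) (F.syzygy (d + 1)) 1, ε = hS.extClass := ⟨_, rfl⟩
    have hε₁ (Y : ModuleCat.{u} R) (i : ℕ) (a : Ext (F.syzygy d) Y (i + 1)) :
        ∃ b : Ext (F.syzygy (d + 1)) Y i, ε.comp b (add_comm 1 i) = a := by
      subst hε
      exact Ext.contravariant_sequence_exact₃ hS Y a
        ((Ext.subsingleton_of_projective (ModuleCat.of R (Fin (F.t d) → R)) Y i).elim _ _)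
        (add_comm 1 i)
    have hε₂ (N : ModuleCat.{u} R) (i : ℕ) (ζ : Ext N (F.syzygy (d + 1)) (i + 1))
        (hζ : ζ.comp (Ext.mk₀ ι) (add_zero (i + 1)) = 0) :
        ∃ ξ : Ext N (F.syzygy d) i, ξ.comp ε rfl = ζ := by
      subst hε
      exact Ext.covariant_sequence_exact₁ N hS ζ hζ rfl
    refine ⟨η.comp ε rfl, fun Y i j hij a => ?_, fun N i j hij hv ζ hζ => ?_⟩
    · obtain ⟨b, rfl⟩ := h₁ Y (i + 1) j (by omega) a
      obtain ⟨c, rfl⟩ := hε₁ Y i b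
      exact ⟨c, Ext.comp_assoc _ _ _ rfl (add_comm 1 i) (by omega)⟩
    · obtain rfl : i + d + 1 = j := by omega
      obtain ⟨ζ', rfl⟩ := hε₂ N (i + d) ζ (by
        rw [Ext.eq_sum_proj_comp_single (ζ.comp _ _)]
        refine Finset.sum_eq_zero fun j _ => ?_
        have h0 : (ζ.comp (Ext.mk₀ ι) (add_zero _)).comp
            (Ext.mk₀ (ModuleCat.ofHom (LinearMap.proj j))) (add_zero _) = 0 := by
          rw [Ext.comp_assoc_of_third_deg_zero, Ext.mk₀_comp_mk₀]
          exact hζ _ fun z => hmem z j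
        rw [h0, Ext.zero_comp])
      obtain ⟨ξ, rfl⟩ := h₂ N i (i + d) rfl (fun l hl => hv l (by omega)) ζ' fun φ _ =>
        (hv (i + d) (by omega)).elim _ _
      exact ⟨ξ, (Ext.comp_assoc _ _ _ rfl rfl (by omega)).symm⟩

end Syzygies

section Pairing

open IsLocalRing

variable {R : Type u} [CommRing R] [IsRegularLocalRing R] {M : Type u} [AddCommGroup M] [Module R M]
  {n i d : ℕ}

/-- A free summand of `Syz^d(M)` makes the pairing
`Ext^{n-d}(k, M) × Ext^d(M, R) → Ext^n(k, R)` nonzero. -/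
theorem exists_comp_ne_zero_of_hasFreeSummand_syzygy (hn : ringKrullDim R = n) (hi : i + d = n)
    (F : MinimalFreeResolution R M) (hF : HasFreeSummand R (F.syzygy d)) :
    ∃ (ξ : Ext (ModuleCat.of R (ResidueField R)) (ModuleCat.of R M) i)
      (a : Ext (ModuleCat.of R M) (ModuleCat.of R R) d), ξ.comp a hi ≠ 0 := by
  obtain ⟨u, hu⟩ := exists_ext_residueField_ne_zero hn
  obtain ⟨σ, π, hσπ⟩ := hF.exists_retract
  obtain ⟨η, -, h₂⟩ := F.exists_syzygy_class d
  obtain ⟨ξ, hξ⟩ := h₂ _ i n hi (fun l hl => subsingleton_ext_residueField_of_lt hn hl)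
    (u.comp (Ext.mk₀ σ) (add_zero n)) fun φ hφ => by
      rw [Ext.comp_assoc_of_third_deg_zero, Ext.mk₀_comp_mk₀]
      exact comp_mk₀_eq_zero_of_apply_one_mem u (σ ≫ φ).hom (hφ _)
  refine ⟨ξ, η.comp (Ext.mk₀ π) (add_zero d), fun h => hu ?_⟩
  rw [← Ext.comp_assoc_of_third_deg_zero, hξ, Ext.comp_assoc_of_third_deg_zero,
    Ext.mk₀_comp_mk₀, hσπ, Ext.comp_mk₀_id] at h
  exact h

/-- If the pairing `Ext^{n-d}(k, M) × Ext^d(M, R) → Ext^n(k, R)` is nonzero, then `Syz^d(M)` has a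
free summand: the second argument comes from a functional on `Syz^d(M)`. If that functional took
values in the maximal ideal it would induce zero on `Ext^n(k, -)`, because `Ext^{n+1}(k, -) = 0`
lets classes lift to a free cover. -/
theorem hasFreeSummand_syzygy_of_comp_ne_zero (hn : ringKrullDim R = n) (hi : i + d = n)
    (F : MinimalFreeResolution R M)
    (ξ : Ext (ModuleCat.of R (ResidueField R)) (ModuleCat.of R M) i)
    (a : Ext (ModuleCat.of R M) (ModuleCat.of R R) d) (h : ξ.comp a hi ≠ 0) :
    HasFreeSummand R (F.syzygy d) := by
  obtain ⟨η, h₁, -⟩ := F.exists_syzygy_class d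
  obtain ⟨b, rfl⟩ := h₁ _ 0 d (add_zero d) a
  obtain ⟨f, rfl⟩ := (Ext.mk₀_bijective _ _).2 b
  obtain ⟨ι, p, w₀, hS, -⟩ := F.exists_syzygy_sequence d
  refine hasFreeSummand_of_surjective f.hom ?_
  rw [← LinearMap.range_eq_top]
  by_contra hne
  have hle : LinearMap.range f.hom ≤ maximalIdeal R := le_maximalIdeal hne
  refine h ?_
  rw [← Ext.comp_assoc_of_third_deg_zero]
  obtain ⟨w, hw⟩ := Ext.covariant_sequence_exact₃ (ModuleCat.of R (ResidueField R)) hS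
    (ξ.comp η hi) rfl ((subsingleton_ext_residueField_succ hn (F.syzygy (d + 1))).elim _ _)
  have hw' : w.comp (Ext.mk₀ p) (add_zero n) = ξ.comp η hi := hw
  rw [← hw', Ext.comp_assoc_of_third_deg_zero, Ext.mk₀_comp_mk₀,
    Ext.eq_sum_proj_comp_single (t := F.t d) w, Ext.sum_comp]
  refine Finset.sum_eq_zero fun j _ => ?_
  rw [Ext.comp_assoc_of_third_deg_zero, Ext.mk₀_comp_mk₀]
  exact comp_mk₀_eq_zero_of_apply_one_mem _
    (f.hom ∘ₗ p.hom ∘ₗ LinearMap.single R (fun _ => R) j) (hle ⟨_, rfl⟩)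

end Pairing

/-! ### Maps from `R / P` to a complete intersection -/

section CompleteIntersection

open IsLocalRing RingTheory.Sequence

variable {R : Type u} [CommRing R] [IsRegularLocalRing R] {n d i : ℕ}

/-- A nonzero map from `R / P` to `T = R / (x₁, …, x_d)`, where `d` is the height of `P`, is
injective: otherwise it factors through some `R / J` with `P < J`, and `Hom(R / J, T)` embeds in
`Ext^d(R / J, R) = 0`. -/
theorem injective_of_ne_zero_of_koszul_class (hn : ringKrullDim R = n) (P : Ideal R) [P.IsPrime]
    (hd : P.height = d) {T : ModuleCat.{u} R} (κ : Ext T (ModuleCat.of R R) d)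
    (hκ : ∀ N : ModuleCat.{u} R, (∀ l < d, Subsingleton (Ext N (ModuleCat.of R R) l)) →
      ∀ x : Ext N T 0, x.comp κ (zero_add d) = 0 → x = 0)
    (α : (R ⧸ P) →ₗ[R] T) (hα : α ≠ 0) : Function.Injective α := by
  by_contra hinj
  refine hα ?_
  set J : Ideal R := LinearMap.ker (α ∘ₗ P.mkQ) with hJ
  have hPJ : P < J := by
    refine lt_of_le_of_ne (fun r hr => ?_) fun h => hinj ?_
    · rw [hJ, LinearMap.mem_ker, LinearMap.comp_apply, Submodule.mkQ_apply,
        (Submodule.Quotient.mk_eq_zero P).2 hr, map_zero]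
    · refine (injective_iff_map_eq_zero α).2 fun a ha => ?_
      obtain ⟨r, rfl⟩ := P.mkQ_surjective a
      have hr : r ∈ J := ha
      exact (Submodule.Quotient.mk_eq_zero P).2 (h ▸ hr)
  have hvan (l : ℕ) (hl : l ≤ d) := subsingleton_ext_quotient_of_lt hn P J hd hPJ hl
  let β : (R ⧸ J) →ₗ[R] T := J.liftQ (α ∘ₗ P.mkQ) le_rfl
  have hβ := hκ (ModuleCat.of R (R ⧸ J)) (fun l hl => hvan l hl.le)
    (Ext.mk₀ (ModuleCat.ofHom β)) ((hvan d le_rfl).elim _ _)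
  rw [Ext.mk₀_eq_zero_iff] at hβ
  have hβ0 : β = 0 := congrArg ModuleCat.Hom.hom hβ
  refine LinearMap.ext fun a => ?_
  obtain ⟨r, rfl⟩ := P.mkQ_surjective a
  exact congrArg (fun f : (R ⧸ J) →ₗ[R] T => f (J.mkQ r)) hβ0

/-- A free summand of `Syz^d(R / P)` yields a map from `R / P` to `T = R / (x₁, …, x_d)` that is
nonzero on `Ext^{n-d}(k, -)`, even after composition with the Koszul class: a class in
`Ext^d(R / P, R)` with nonzero pairing lifts to `Hom(R / P, T)`. -/
theorem exists_hom_comp_koszul_class_ne_zero (hn : ringKrullDim R = n) (hi : i + d = n)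
    {N T : ModuleCat.{u} R} (κ : Ext T (ModuleCat.of R R) d)
    (hκ : ∀ y : Ext N (ModuleCat.of R R) d, ∃ x : Ext N T 0, x.comp κ (zero_add d) = y)
    (F : MinimalFreeResolution R N) (hF : HasFreeSummand R (F.syzygy d)) :
    ∃ (α : N ⟶ T) (ξ : Ext (ModuleCat.of R (ResidueField R)) N i),
      (ξ.comp (Ext.mk₀ α) (add_zero i)).comp κ hi ≠ 0 := by
  obtain ⟨ξ, a, h⟩ := exists_comp_ne_zero_of_hasFreeSummand_syzygy hn hi F hF
  obtain ⟨x, rfl⟩ := hκ a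
  obtain ⟨α, rfl⟩ := (Ext.mk₀_bijective _ _).2 x
  refine ⟨α, ξ, ?_⟩
  rwa [Ext.comp_assoc_of_second_deg_zero]

/-- A free summand passes from the `d`-th syzygy of `R / P` to that of `Ω = Ext^d(R / P, R)`. With
`T = R / (x₁, …, x_d)` one has `Ω ≃ Hom(R / P, T)`, the elements of `T` killed by `P`; the map
`R / P → T` detecting the free summand factors through the inclusion `Ω → T`, so this inclusion is
nonzero on `Ext^{n-d}(k, -)` as well. -/
theorem hasFreeSummand_syzygy_ext (hn : ringKrullDim R = n) (P : Ideal R) [P.IsPrime]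
    (hd : P.height = d) (hi : i + d = n) (F : MinimalFreeResolution R (R ⧸ P))
    (hF : HasFreeSummand R (F.syzygy d))
    (L : MinimalFreeResolution R (ExtModule R (R ⧸ P) R d)) :
    HasFreeSummand R (L.syzygy d) := by
  obtain ⟨rs, rfl, hmem, hreg⟩ := exists_isRegular_of_height hn P hd
  let T : ModuleCat.{u} R := ModuleCat.of R (R ⧸ (Ideal.ofList rs • ⊤ : Submodule R R))
  obtain ⟨κ, hsurj, hinj⟩ := exists_koszul_class rs (ModuleCat.of R R) T (LinearEquiv.refl R _)
    hreg.1
  have hann (r) (hr : r ∈ P) : r ∈ Module.annihilator R (ModuleCat.of R (R ⧸ P)) := by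
    rwa [← Ideal.annihilator_quotient (I := P)] at hr
  have hsurj₀ := hsurj (ModuleCat.of R (R ⧸ P)) (fun r hr => hann r (hmem r hr)) 0 _ (zero_add _)
  obtain ⟨α, ξ, hα⟩ := exists_hom_comp_koszul_class_ne_zero hn hi κ hsurj₀ F hF
  let Φ : (ModuleCat.of R (R ⧸ P) ⟶ T) ≃ₗ[R] ExtModule R (R ⧸ P) R rs.length :=
    (Ext.linearEquiv₀ (R := R)).symm.trans (LinearEquiv.ofBijective
      (κ.postcompOfLinear R (ModuleCat.of R (R ⧸ P)) (zero_add _))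
      ⟨(injective_iff_map_eq_zero _).2 fun x hx => hinj _ 0 _ (zero_add _)
        (fun l hl => subsingleton_ext_quotient_of_lt_height hn P hd hl) x hx, hsurj₀⟩)
  let ι : ExtModule R (R ⧸ P) R rs.length →ₗ[R] T :=
    LinearMap.applyₗ (1 : R ⧸ P) ∘ₗ ModuleCat.homLinearEquiv.toLinearMap ∘ₗ Φ.symm.toLinearMap
  let τ : (R ⧸ P) →ₗ[R] ExtModule R (R ⧸ P) R rs.length :=
    P.liftQ (LinearMap.toSpanSingleton R _ (Φ α)) fun r hr =>
      Ext.smul_eq_zero_of_mem_annihilator (hann r hr) (Φ α)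
  have hτι : ModuleCat.ofHom τ ≫ ModuleCat.ofHom ι = α := by
    refine ModuleCat.hom_ext (Submodule.linearMap_qext _ (LinearMap.ext_ring ?_))
    change ι ((1 : R) • Φ α) = α.hom 1
    rw [one_smul]
    change (Φ.symm (Φ α)).hom 1 = α.hom 1
    rw [Φ.symm_apply_apply]
  refine hasFreeSummand_syzygy_of_comp_ne_zero hn hi L
    (ξ.comp (Ext.mk₀ (ModuleCat.ofHom τ)) (add_zero i))
    ((Ext.mk₀ (ModuleCat.ofHom ι)).comp κ (zero_add _)) ?_
  rwa [← Ext.comp_assoc_of_second_deg_zero, Ext.comp_assoc_of_third_deg_zero ξ,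
    Ext.mk₀_comp_mk₀, hτι]

end CompleteIntersection

theorem theorem3p3 (R : Type u) [CommRing R] [IsRegularLocalRing R]
    [IsAdicComplete (IsLocalRing.maximalIdeal R) R]
    (n : ℕ) (hn : ringKrullDim R = n)
    (P : Ideal R) [P.IsPrime] (d : ℕ) (hd : P.height = d)
    (F : MinimalFreeResolution R (R ⧸ P)) (hF : HasFreeSummand R (F.syzygy d)) :
    (∀ x : Fin d → R, (∀ i, x i ∈ P) → RingTheory.Sequence.IsRegular R (List.ofFn x) →
      ∃ (μ : R ⧸ Ideal.span (Set.range x)) (α : (R ⧸ P) →ₗ[R] (R ⧸ Ideal.span (Set.range x))),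
        α 1 = μ ∧ Function.Injective α ∧
          ExtModule.map R (IsLocalRing.ResidueField R) α (n - d) ≠ 0) ∧
    ∀ L : MinimalFreeResolution R (ExtModule R (R ⧸ P) R d), HasFreeSummand R (L.syzygy d) := by
  -- So the natural number subtraction `n - d` is not truncated.
  have hdn : d ≤ n := by
    have h := Ideal.height_le_ringKrullDim_of_ne_top (Ideal.IsPrime.ne_top ‹P.IsPrime›)
    rw [hd, hn] at h
    exact_mod_cast h
  have hi : n - d + d = n := Nat.sub_add_cancel hdn
  refine ⟨fun x hx hreg => ?_, hasFreeSummand_syzygy_ext hn P hd hi F hF⟩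
  have hspan : Ideal.span (Set.range x) = (Ideal.ofList (List.ofFn x) • ⊤ : Submodule R R) := by
    rw [smul_eq_mul, Ideal.mul_top, Ideal.ofList]
    congr 1
    ext r
    simp
  obtain ⟨κ, hsurj, hinj⟩ := exists_koszul_class (List.ofFn x) (ModuleCat.of R R)
    (ModuleCat.of R (R ⧸ Ideal.span (Set.range x))) (Submodule.quotEquivOfEq _ _ hspan) hreg.1
  generalize hlen : (List.ofFn x).length = d' at κ hsurj hinj
  obtain rfl : d' = d := by simpa using hlen.symm
  have hann (r) (hr : r ∈ List.ofFn x) : r ∈ Module.annihilator R (ModuleCat.of R (R ⧸ P)) := by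
    obtain ⟨i, rfl⟩ := List.mem_ofFn.1 hr
    have := hx i
    rwa [← Ideal.annihilator_quotient (I := P)] at this
  obtain ⟨α, ξ, hα⟩ := exists_hom_comp_koszul_class_ne_zero hn hi κ
    (hsurj (ModuleCat.of R (R ⧸ P)) hann 0 _ (zero_add _)) F hF
  have hξ : ξ.comp (Ext.mk₀ α) (add_zero _) ≠ 0 := fun h => hα (by rw [h, Ext.zero_comp])
  have hmap : ExtModule.map R (IsLocalRing.ResidueField R) α.hom (n - d') ≠ 0 :=
    fun h => hξ (congrArg (fun f => f ξ) h)
  refine ⟨α.hom 1, α.hom, rfl, ?_, hmap⟩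
  refine injective_of_ne_zero_of_koszul_class hn P hd κ
    (fun N hv x hx => hinj N 0 _ (zero_add _) hv x hx) α.hom fun h => hξ ?_
  have h0 : α = 0 := ModuleCat.hom_ext h
  rw [h0, Ext.mk₀_zero, Ext.comp_zero]
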